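/- For positive integers $n,d$ let $\Gamma_n^d$ be the set of $n\times n$ $(0,1)$-matrices in which every row has exactly $d$ non-zero entries and these occupy $d$ consecutive columns. Let $$M_n^d=\{A\in\Gamma_n^d : \operatorname{per}(A)\ge \operatorname{per}(B)\ \text{for all } B\in\Gamma_n^d\},$$ where $\operatorname{per}$ denotes the permanent. Let $1_{d\times d}$ be the $d\times d$ all-ones matrix, and let $A\oplus B=\begin{pmatrix}A&0\\0&B\end{pmatrix}$ denote the direct sum of square matrices. Then for each positive integer $d$ there exists $\mu_d$ such that $M_n^d$ is periodic for $n\ge\mu_d$, in the following sense: for every $n\ge\mu_d$ and every $n\times n$ matrix $A$ with non-negative integer entries, $A\in M_n^d$ if and only if $A\oplus 1_{d\times d}\in M_{n+d}^d$. -/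

import Mathlib

/-- `Gam n d`: the `(0,1)`-matrices of order `n` with exactly `d` non-zero entries in each row,
which form a contiguous block. -/
def Gam (n d : ℕ) : Set (Matrix (Fin n) (Fin n) ℕ) :=
  {A | (∀ i j, A i j = 0 ∨ A i j = 1) ∧
    ∀ i, (Finset.univ.filter fun j => A i j ≠ 0).card = d ∧ {j | A i j ≠ 0}.OrdConnected}

/-- `MaxPer n d`: the matrices of `Gam n d` whose permanent is largest in `Gam n d`. -/
def MaxPer (n d : ℕ) : Set (Matrix (Fin n) (Fin n) ℕ) :=
  {A | A ∈ Gam n d ∧ ∀ B ∈ Gam n d, B.permanent ≤ A.permanent}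

/-- The all-ones square matrix of order `d`. -/
def allOnes (d : ℕ) : Matrix (Fin d) (Fin d) ℕ := Matrix.of fun _ _ => 1

/-- The direct sum of two square matrices: block-diagonal, with `A` in the upper left corner and
`B` in the lower right corner. -/
def directSum {m n : ℕ} (A : Matrix (Fin m) (Fin m) ℕ) (B : Matrix (Fin n) (Fin n) ℕ) :
    Matrix (Fin (m + n)) (Fin (m + n)) ℕ :=
  Matrix.reindex finSumFinEquiv finSumFinEquiv (Matrix.fromBlocks A 0 0 B)

/-! Cancelling the factor `d!` gives one direction. For the other, take a competitor `B` of order `n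
+ d`. If `B` has an isolated `d × d` all-ones block, deleting it leaves a matrix of `Gam n d` and
divides the permanent by `d!`. Otherwise `B` cannot win: Brègman's bound is `d! ^ ((n + d) / d)`,
and without blocks the logarithmic loss against it grows linearly in `n` (`gap_mul_le`), while
all-ones blocks plus a remainder lose only a bounded amount (`exists_mem_Gam_le_permanent`).

The linear loss is a stability version of Brègman's inequality. Fix a compatible `σ` and pair row
`i` with column `σ i`; then `#(cls R F σ)` is the permanent of the submatrix with rows `F` and
columns `σ F`, and `deficit` is its loss. The entropy argument shows that the loss at `F`, summed
over `σ`, is at least its average over the sets `F.erase i`, so the loss of the whole matrix is at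
least the average over all `F` (`sum_deficit_le`). Without blocks, every window of columns holds a
pattern of two or three rows with loss at least `gap`. A random `F` cuts out exactly this pattern in
its window with probability bounded below, and the losses of isolated patterns add up
(`le_sum_deficit`). -/

open Finset

set_option linter.unusedSectionVars false

/-! ### Brègman's inequality by averaging over deleted rows -/

namespace Bregman

variable {ι : Type*} [Fintype ι] [DecidableEq ι] (R : ι → ι → Prop) [DecidableRel R]

/-- The permutations whose graph is contained in the relation `R`. -/
def compat : Finset (Equiv.Perm ι) := univ.filter fun σ => ∀ i, R i (σ i)

/-- The compatible permutations that agree with `σ` outside `F`. -/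
def cls (F : Finset ι) (σ : Equiv.Perm ι) : Finset (Equiv.Perm ι) :=
  (compat R).filter fun τ => ∀ i ∉ F, τ i = σ i

/-- The number of columns of row `i` that are available when the rows outside `F` are assigned
according to `σ`. -/
def avail (F : Finset ι) (σ : Equiv.Perm ι) (i : ι) : ℕ := #{k ∈ F | R i (σ k)}

/-- The contribution `log (r!) / r` of a row with `r` ones to Brègman's bound. -/
noncomputable def phi (r : ℕ) : ℝ := Real.log r.factorial / r

/-- The difference between Brègman's bound and the logarithm of the permanent, for the submatrix
with rows `F` and columns `σ F`. -/
noncomputable def deficit (F : Finset ι) (σ : Equiv.Perm ι) : ℝ :=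
  ∑ i ∈ F, phi (avail R F σ i) - Real.log #(cls R F σ)

variable {R} {F : Finset ι} {σ τ : Equiv.Perm ι}

lemma mem_compat : σ ∈ compat R ↔ ∀ i, R i (σ i) := by simp [compat]

lemma mem_cls : τ ∈ cls R F σ ↔ τ ∈ compat R ∧ ∀ i ∉ F, τ i = σ i := by simp [cls]

lemma image_eq_of_agree (h : ∀ i ∉ F, τ i = σ i) : F.image τ = F.image σ := by
  have key : ∀ α β : Equiv.Perm ι, (∀ i ∉ F, α i = β i) → F.image α ⊆ F.image β := by
    intro α β h c hc
    obtain ⟨i, hi, rfl⟩ := mem_image.1 hc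
    refine mem_image.2 ⟨β.symm (α i), ?_, by simp⟩
    by_contra hk
    have h1 := h _ hk
    rw [Equiv.apply_symm_apply] at h1
    have h2 := α.injective h1
    exact hk (h2.symm ▸ hi)
  exact (key _ _ h).antisymm (key _ _ fun i hi => (h i hi).symm)

lemma avail_eq_card_image (i : ι) : avail R F σ i = #{c ∈ F.image σ | R i c} := by
  rw [avail, filter_image, card_image_of_injective _ σ.injective]

lemma avail_eq_of_agree (h : ∀ i ∉ F, τ i = σ i) (i : ι) : avail R F τ i = avail R F σ i := by
  rw [avail_eq_card_image, avail_eq_card_image, image_eq_of_agree h]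

lemma cls_eq_of_agree (h : ∀ i ∉ F, τ i = σ i) : cls R F τ = cls R F σ := by
  ext α
  simp only [mem_cls]
  exact and_congr_right fun _ => forall₂_congr fun i hi => by rw [h i hi]

lemma self_mem_cls (hσ : σ ∈ compat R) : σ ∈ cls R F σ := mem_cls.2 ⟨hσ, fun _ _ => rfl⟩

lemma mem_cls_comm (hσ : σ ∈ compat R) (h : τ ∈ cls R F σ) : σ ∈ cls R F τ :=
  mem_cls.2 ⟨hσ, fun i hi => ((mem_cls.1 h).2 i hi).symm⟩

lemma card_cls_pos (hσ : σ ∈ compat R) : 0 < #(cls R F σ) := card_pos.2 ⟨σ, self_mem_cls hσ⟩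

lemma avail_pos (hσ : σ ∈ compat R) {i : ι} (hi : i ∈ F) : 0 < avail R F σ i :=
  card_pos.2 ⟨i, mem_filter.2 ⟨hi, mem_compat.1 hσ i⟩⟩

lemma deficit_eq_of_mem_cls (h : τ ∈ cls R F σ) : deficit R F τ = deficit R F σ := by
  have h2 := (mem_cls.1 h).2
  simp only [deficit, cls_eq_of_agree h2, avail_eq_of_agree h2]

/-- The members of a class with a given value at `i` lie in one class for `F.erase i`, so together
they contribute at most 1; only `avail` values are possible. -/
lemma sum_inv_card_cls_erase_le {i : ι} (hi : i ∈ F) :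
    ∑ α ∈ cls R F σ, (1 : ℝ) / #(cls R (F.erase i) α) ≤ avail R F σ i := by
  have hmaps : ∀ α ∈ cls R F σ, α i ∈ (F.image σ).filter (R i) := by
    intro α hα
    obtain ⟨h1, h2⟩ := mem_cls.1 hα
    refine mem_filter.2 ⟨?_, mem_compat.1 h1 i⟩
    rw [← image_eq_of_agree h2]
    exact mem_image_of_mem _ hi
  rw [← sum_fiberwise_of_maps_to hmaps, avail_eq_card_image]
  calc _ ≤ ∑ _c ∈ (F.image σ).filter (R i), (1 : ℝ) := ?_
    _ = _ := by simp
  refine sum_le_sum fun c _ => ?_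
  rcases ((cls R F σ).filter fun α => α i = c).eq_empty_or_nonempty with h0 | ⟨β, hβ⟩
  · rw [h0]; simp
  obtain ⟨hβ1, hβ2⟩ := mem_filter.1 hβ
  have hagree : ∀ α ∈ (cls R F σ).filter (fun α => α i = c), ∀ k ∉ F.erase i, α k = β k := by
    intro α hα k hk
    obtain ⟨hα1, hα2⟩ := mem_filter.1 hα
    by_cases hki : k = i
    · rw [hki, hα2, hβ2]
    · have hkF : k ∉ F := fun h => hk (mem_erase.2 ⟨hki, h⟩)
      rw [(mem_cls.1 hα1).2 k hkF, (mem_cls.1 hβ1).2 k hkF]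
  have hsub : (cls R F σ).filter (fun α => α i = c) ⊆ cls R (F.erase i) β := fun α hα =>
    mem_cls.2 ⟨(mem_cls.1 (mem_filter.1 hα).1).1, hagree α hα⟩
  rw [sum_congr rfl fun α hα => by rw [cls_eq_of_agree (hagree α hα)], sum_const, nsmul_eq_mul,
    mul_one_div]
  exact div_le_one_of_le₀ (by exact_mod_cast card_le_card hsub) (by positivity)

/-- Apply `log x ≤ x - 1` to the ratio of the two sides inside the logarithm. Closure of `S` under
classes permits the double count; `S` will be a single class (Brègman's inequality) or all of
`compat R` (stability). -/
lemma sum_log_card_cls_le {S : Finset (Equiv.Perm ι)} (hS : S ⊆ compat R)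
    (hcl : ∀ σ ∈ S, cls R F σ ⊆ S) {i : ι} (hi : i ∈ F) :
    ∑ σ ∈ S, Real.log #(cls R F σ) ≤
      ∑ σ ∈ S, (Real.log #(cls R (F.erase i) σ) + Real.log (avail R F σ i)) := by
  have key : ∑ σ ∈ S, (#(cls R F σ) : ℝ) / (#(cls R (F.erase i) σ) * avail R F σ i) ≤ #S := by
    calc _ = ∑ σ ∈ S, ∑ τ ∈ cls R F σ, (1 : ℝ) / #(cls R (F.erase i) σ) / avail R F τ i := by
          refine sum_congr rfl fun σ _ => ?_
          rw [sum_congr rfl fun τ hτ => by rw [avail_eq_of_agree (mem_cls.1 hτ).2], sum_const,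
            nsmul_eq_mul]
          ring
      _ = ∑ τ ∈ S, ∑ σ ∈ cls R F τ, (1 : ℝ) / #(cls R (F.erase i) σ) / avail R F τ i := by
          refine sum_comm' fun σ τ => ⟨fun h => ?_, fun h => ?_⟩
          · exact ⟨mem_cls_comm (hS h.1) h.2, hcl _ h.1 h.2⟩
          · exact ⟨hcl _ h.2 h.1, mem_cls_comm (hS h.2) h.1⟩
      _ ≤ ∑ τ ∈ S, (1 : ℝ) := by
          refine sum_le_sum fun τ _ => ?_
          rw [← sum_div]
          exact div_le_one_of_le₀ (sum_inv_card_cls_erase_le hi) (by positivity)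
      _ = _ := by simp
  have hlog : ∀ σ ∈ S, Real.log #(cls R F σ) -
      (Real.log #(cls R (F.erase i) σ) + Real.log (avail R F σ i)) ≤
      (#(cls R F σ) : ℝ) / (#(cls R (F.erase i) σ) * avail R F σ i) - 1 := by
    intro σ hσ
    have h1 : (0 : ℝ) < #(cls R F σ) := by exact_mod_cast card_cls_pos (hS hσ)
    have h2 : (0 : ℝ) < #(cls R (F.erase i) σ) := by exact_mod_cast card_cls_pos (hS hσ)
    have h3 : (0 : ℝ) < avail R F σ i := by exact_mod_cast avail_pos (hS hσ) hi
    rw [← Real.log_mul h2.ne' h3.ne', ← Real.log_div h1.ne' (mul_pos h2 h3).ne']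
    exact Real.log_le_sub_one_of_pos (by positivity)
  have := sum_le_sum hlog
  rw [sum_sub_distrib, sum_sub_distrib, sum_const, nsmul_eq_mul, mul_one] at this
  linarith

lemma natCast_mul_phi (r : ℕ) : (r : ℝ) * phi r = Real.log r.factorial := by
  rcases r.eq_zero_or_pos with rfl | h
  · simp
  · have : (r : ℝ) ≠ 0 := by positivity
    rw [phi]; field_simp

lemma avail_erase (i j : ι) (hi : i ∈ F) :
    avail R (F.erase i) σ j = if R j (σ i) then avail R F σ j - 1 else avail R F σ j := by
  rw [avail, filter_erase, card_erase_eq_ite]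
  simp [hi, avail]

/-- This identity dictates the form of `phi`. With `r` available columns, `r - 1` of the deletions
lower `r` by one and `#F - r` leave it alone, while `(r - 1) * phi (r - 1) + log r = r * phi r`. -/
lemma sum_phi_avail_erase (hσ : σ ∈ compat R) {j : ι} (hj : j ∈ F) :
    ∑ i ∈ F.erase j, phi (avail R (F.erase i) σ j) + Real.log (avail R F σ j) =
      #F * phi (avail R F σ j) := by
  rw [sum_congr rfl fun i hi => by rw [avail_erase i j (mem_of_mem_erase hi), apply_ite phi],
    sum_ite, sum_const, sum_const, nsmul_eq_mul, nsmul_eq_mul]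
  have hab := card_filter_add_card_filter_not (s := F.erase j) (fun i => R j (σ i))
  have ha : #{i ∈ F.erase j | R j (σ i)} + 1 = avail R F σ j := by
    rw [filter_erase, avail]
    exact card_erase_add_one (mem_filter.2 ⟨hj, mem_compat.1 hσ j⟩)
  have hF := card_erase_add_one hj
  set a := #{i ∈ F.erase j | R j (σ i)}
  set b := #{i ∈ F.erase j | ¬ R j (σ i)}
  rw [← ha, ← hF, ← hab, Nat.add_sub_cancel]
  have h1 := natCast_mul_phi a
  have h2 := natCast_mul_phi (a + 1)
  rw [Nat.factorial_succ, Nat.cast_mul, Real.log_mul (by positivity) (by positivity)] at h2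
  push_cast at *
  linarith

lemma sum_deficit_erase_le {S : Finset (Equiv.Perm ι)} (hS : S ⊆ compat R)
    (hcl : ∀ σ ∈ S, cls R F σ ⊆ S) :
    ∑ i ∈ F, ∑ σ ∈ S, deficit R (F.erase i) σ ≤ #F * ∑ σ ∈ S, deficit R F σ := by
  have h1 : ∀ σ ∈ S, ∑ i ∈ F, (∑ j ∈ F.erase i, phi (avail R (F.erase i) σ j) +
      Real.log (avail R F σ i)) = #F * ∑ j ∈ F, phi (avail R F σ j) := by
    intro σ hσ
    rw [mul_sum, ← sum_congr rfl fun j hj => sum_phi_avail_erase (hS hσ) hj, sum_add_distrib,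
      sum_add_distrib]
    congr 1
    refine sum_comm' fun i j => ?_
    simp only [mem_erase]
    tauto
  have h2 := sum_le_sum fun i (hi : i ∈ F) => sum_log_card_cls_le hS hcl hi
  rw [sum_const, nsmul_eq_mul] at h2
  simp only [deficit, sum_sub_distrib, mul_sub]
  rw [mul_sum S, ← sum_congr rfl h1, sum_comm (s := S)]
  simp only [sum_add_distrib] at h2 ⊢
  linarith

lemma deficit_empty (hσ : σ ∈ compat R) : deficit R ∅ σ = 0 := by
  have : cls R ∅ σ = {σ} := by
    ext τ
    rw [mem_cls, mem_singleton]
    refine ⟨fun h => Equiv.ext fun i => h.2 i (notMem_empty i), ?_⟩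
    rintro rfl
    exact ⟨hσ, fun _ _ => rfl⟩
  simp [deficit, this]

/-- **Brègman's inequality**, for the submatrix with rows `F` and columns `σ F`. -/
lemma deficit_nonneg (hσ : σ ∈ compat R) : 0 ≤ deficit R F σ := by
  induction F using Finset.strongInduction generalizing σ with
  | H F ih =>
    rcases F.eq_empty_or_nonempty with rfl | hF
    · exact (deficit_empty hσ).ge
    -- The deficit at `F` is constant on this class, so the sum on the right is a multiple of the
    -- deficit of `σ`.
    have h := sum_deficit_erase_le (R := R) (F := F) (S := cls R F σ)
      (fun τ hτ => (mem_cls.1 hτ).1)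
      (fun τ hτ => (cls_eq_of_agree (mem_cls.1 hτ).2).subset)
    rw [sum_congr (s₁ := cls R F σ) rfl fun τ hτ => deficit_eq_of_mem_cls hτ, sum_const,
      nsmul_eq_mul] at h
    have h0 : 0 ≤ ∑ i ∈ F, ∑ τ ∈ cls R F σ, deficit R (F.erase i) τ :=
      sum_nonneg fun i hi => sum_nonneg fun τ hτ => ih _ (erase_ssubset hi) (mem_cls.1 hτ).1
    have h1 : (0 : ℝ) < #F := by exact_mod_cast card_pos.2 hF
    have h2 : (0 : ℝ) < #(cls R F σ) := by exact_mod_cast card_cls_pos hσ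
    exact nonneg_of_mul_nonneg_right (nonneg_of_mul_nonneg_right (h0.trans h) h1) h2

/-! ### Averaging over all subsets of rows -/

lemma sum_powersetCard_erase (f : Finset ι → ℝ) (m : ℕ) :
    ∑ F ∈ powersetCard (m + 1) univ, ∑ i ∈ F, f (F.erase i) =
      ∑ G ∈ powersetCard m univ, ((Fintype.card ι - m : ℕ) : ℝ) * f G := by
  have : ∀ G ∈ powersetCard m (univ : Finset ι),
      ((Fintype.card ι - m : ℕ) : ℝ) * f G = ∑ _i ∈ Gᶜ, f G := by
    intro G hG
    rw [sum_const, nsmul_eq_mul, card_compl, (mem_powersetCard.1 hG).2]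
  rw [sum_congr rfl this, sum_sigma', sum_sigma']
  refine sum_bij' (fun x _ => ⟨x.1.erase x.2, x.2⟩) (fun x _ => ⟨insert x.2 x.1, x.2⟩) ?_ ?_ ?_ ?_ ?_
  · rintro ⟨F, i⟩ h
    simp only [mem_sigma, mem_powersetCard_univ, mem_compl] at h ⊢
    simp [card_erase_of_mem h.2, h.1]
  · rintro ⟨F, i⟩ h
    simp only [mem_sigma, mem_powersetCard_univ, mem_compl] at h ⊢
    simp [card_insert_of_notMem h.2, h.1]
  · rintro ⟨F, i⟩ h
    simp only [mem_sigma, mem_powersetCard_univ] at h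
    simp [insert_erase h.2]
  · rintro ⟨F, i⟩ h
    simp only [mem_sigma, mem_powersetCard_univ, mem_compl] at h
    simp [erase_insert h.2]
  · rintro ⟨F, i⟩ h
    rfl

/-- If the value of a set function at `F` is at least its average over the sets `F \ {i}`, then
its value at the whole space is at least its average over all sets. -/
lemma sum_le_two_pow_mul_univ (f : Finset ι → ℝ)
    (hf : ∀ F : Finset ι, ∑ i ∈ F, f (F.erase i) ≤ #F * f F) :
    ∑ F : Finset ι, f F ≤ 2 ^ Fintype.card ι * f univ := by
  set n := Fintype.card ι with hn
  -- Downward induction on `m`: the average over `m`-sets is at most the average over `(m +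
  -- 1)`-sets.
  have key : ∀ k m, m + k = n → ∑ F ∈ powersetCard m univ, f F ≤ n.choose m * f univ := by
    intro k
    induction k with
    | zero =>
      intro m hm
      obtain rfl : m = n := by omega
      rw [hn, ← card_univ, powersetCard_self]
      simp
    | succ k ih =>
      intro m hm
      have h1 := ih (m + 1) (by omega)
      have h2 := sum_powersetCard_erase f m
      have h3 : ∑ F ∈ powersetCard (m + 1) univ, ∑ i ∈ F, f (F.erase i) ≤
          (m + 1 : ℝ) * ∑ F ∈ powersetCard (m + 1) univ, f F := by
        rw [mul_sum]
        refine sum_le_sum fun F hF => (hf F).trans_eq ?_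
        rw [(mem_powersetCard.1 hF).2]; push_cast; rfl
      rw [h2, ← mul_sum, ← hn] at h3
      have h4 : ((n.choose (m + 1) : ℕ) : ℝ) * (m + 1) = n.choose m * ((n - m : ℕ) : ℝ) := by
        exact_mod_cast Nat.choose_succ_right_eq n m
      have h5 : (0 : ℝ) < ((n - m : ℕ) : ℝ) := by
        have : 0 < n - m := by omega
        exact_mod_cast this
      have h6 : (m + 1 : ℝ) * ∑ F ∈ powersetCard (m + 1) univ, f F ≤
          (m + 1) * (n.choose (m + 1) * f univ) := by gcongr
      refine le_of_mul_le_mul_left ((h3.trans h6).trans_eq ?_) h5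
      linear_combination f univ * h4
  have hsum : ∑ F : Finset ι, f F = ∑ m ∈ range (n + 1), ∑ F ∈ powersetCard m univ, f F := by
    rw [← powerset_univ, sum_powerset, card_univ]
  rw [hsum]
  calc _ ≤ ∑ m ∈ range (n + 1), (n.choose m : ℝ) * f univ :=
        sum_le_sum fun m hm => key (n - m) m (by have := mem_range.1 hm; omega)
    _ = _ := by
        rw [← sum_mul]
        congr 1
        exact_mod_cast Nat.sum_range_choose n

lemma sum_deficit_le :
    ∑ F : Finset ι, ∑ σ ∈ compat R, deficit R F σ ≤
      2 ^ Fintype.card ι * ∑ σ ∈ compat R, deficit R univ σ :=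
  sum_le_two_pow_mul_univ _ fun _ =>
    sum_deficit_erase_le subset_rfl fun _ _ _ hτ => (mem_cls.1 hτ).1

end Bregman

/-! ### Superadditivity of the deficit over isolated patterns -/

namespace Bregman

variable {ι : Type*} [Fintype ι] [DecidableEq ι] {R : ι → ι → Prop} [DecidableRel R]
variable {F : Finset ι} {σ τ : Equiv.Perm ι}

/-- Splice `τ` on `G` with `σ` elsewhere. No row of `G` reaches a column of `σ H`, so `τ` maps `G`
into `σ G` and no value is repeated. -/
lemma exists_mem_cls_of_no_edges {G H : Finset ι} (hσ : σ ∈ compat R)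
    (hGH : ∀ g ∈ G, ∀ h ∈ H, ¬ R g (σ h)) (hτ : τ ∈ cls R (G ∪ H) σ) :
    ∃ α ∈ cls R G σ, ∀ i ∈ G, α i = τ i := by
  obtain ⟨h1, h2⟩ := mem_cls.1 hτ
  have hG : ∀ i ∈ G, ∃ g ∈ G, σ g = τ i := by
    intro i hi
    have : τ i ∈ (G ∪ H).image σ := by
      rw [← image_eq_of_agree h2]
      exact mem_image_of_mem _ (mem_union_left _ hi)
    obtain ⟨g, hg, hgi⟩ := mem_image.1 this
    refine ⟨g, (mem_union.1 hg).resolve_right fun hgH => hGH i hi g hgH ?_, hgi⟩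
    rw [hgi]
    exact mem_compat.1 h1 i
  let f : ι → ι := fun i => if i ∈ G then τ i else σ i
  have hf : Function.Injective f := by
    intro i j hij
    simp only [f] at hij
    split_ifs at hij with hi hj hj
    · exact τ.injective hij
    · obtain ⟨g, hg, hgi⟩ := hG i hi
      exact absurd (σ.injective (hgi.trans hij) ▸ hg) hj
    · obtain ⟨g, hg, hgj⟩ := hG j hj
      exact absurd (σ.injective (hgj.trans hij.symm) ▸ hg) hi
    · exact σ.injective hij
  refine ⟨Equiv.ofBijective f (Finite.injective_iff_bijective.1 hf), ?_, ?_⟩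
  · refine mem_cls.2 ⟨mem_compat.2 fun i => ?_, fun i hi => ?_⟩
    · simp only [Equiv.ofBijective_apply, f]
      split_ifs
      · exact mem_compat.1 h1 i
      · exact mem_compat.1 hσ i
    · simp [f, hi]
  · intro i hi
    simp [f, hi]

lemma card_cls_union_le {G H : Finset ι} (hσ : σ ∈ compat R)
    (hGH : ∀ g ∈ G, ∀ h ∈ H, ¬ R g (σ h)) (hHG : ∀ h ∈ H, ∀ g ∈ G, ¬ R h (σ g)) :
    #(cls R (G ∪ H) σ) ≤ #(cls R G σ) * #(cls R H σ) := by
  have h1 : ∀ τ, τ ∈ cls R (G ∪ H) σ → ∃ α ∈ cls R G σ, ∀ i ∈ G, α i = τ i := fun τ hτ =>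
    exists_mem_cls_of_no_edges hσ hGH hτ
  have h2 : ∀ τ, τ ∈ cls R (G ∪ H) σ → ∃ α ∈ cls R H σ, ∀ i ∈ H, α i = τ i := fun τ hτ =>
    exists_mem_cls_of_no_edges hσ hHG (by rwa [union_comm])
  choose! a ha ha' using h1
  choose! b hb hb' using h2
  rw [← card_product]
  refine card_le_card_of_injOn (fun τ => (a τ, b τ))
    (fun τ hτ => mem_product.2 ⟨ha τ hτ, hb τ hτ⟩) ?_
  intro τ hτ τ' hτ' h
  obtain ⟨e1, e2⟩ := Prod.mk.inj h
  ext i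
  by_cases hi : i ∈ G
  · rw [← ha' τ hτ i hi, ← ha' τ' hτ' i hi, e1]
  by_cases hi' : i ∈ H
  · rw [← hb' τ hτ i hi', ← hb' τ' hτ' i hi', e2]
  have hu : i ∉ G ∪ H := by simp [hi, hi']
  rw [(mem_cls.1 hτ).2 i hu, (mem_cls.1 hτ').2 i hu]

lemma avail_union_of_no_edges {G H : Finset ι} {g : ι} (h : ∀ k ∈ H, ¬ R g (σ k)) :
    avail R (G ∪ H) σ g = avail R G σ g := by
  rw [avail, avail, filter_union, filter_eq_empty_iff.2 fun k hk => h k hk, union_empty]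

lemma deficit_add_le_deficit_union {G H : Finset ι} (hσ : σ ∈ compat R) (hd : Disjoint G H)
    (hGH : ∀ g ∈ G, ∀ h ∈ H, ¬ R g (σ h)) (hHG : ∀ h ∈ H, ∀ g ∈ G, ¬ R h (σ g)) :
    deficit R G σ + deficit R H σ ≤ deficit R (G ∪ H) σ := by
  have h1 : (0 : ℝ) < #(cls R G σ) := by exact_mod_cast card_cls_pos hσ
  have h2 : (0 : ℝ) < #(cls R H σ) := by exact_mod_cast card_cls_pos hσ
  have h3 : (0 : ℝ) < #(cls R (G ∪ H) σ) := by exact_mod_cast card_cls_pos hσ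
  have hlog : Real.log #(cls R (G ∪ H) σ) ≤ Real.log #(cls R G σ) + Real.log #(cls R H σ) := by
    rw [← Real.log_mul h1.ne' h2.ne']
    exact Real.log_le_log h3 (by exact_mod_cast card_cls_union_le hσ hGH hHG)
  have hG : ∑ g ∈ G, phi (avail R (G ∪ H) σ g) = ∑ g ∈ G, phi (avail R G σ g) :=
    sum_congr rfl fun g hg => by rw [avail_union_of_no_edges (hGH g hg)]
  have hH : ∑ g ∈ H, phi (avail R (G ∪ H) σ g) = ∑ g ∈ H, phi (avail R H σ g) :=
    sum_congr rfl fun g hg => by rw [union_comm, avail_union_of_no_edges (hHG g hg)]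
  simp only [deficit]
  rw [sum_union hd, hG, hH]
  linarith

variable {κ : Type*} [DecidableEq κ]

/-- Peel off one pattern at a time: the neighbours of `G s` lie in `W s`, which `F` meets only in `G
s`, so no edge joins `G s` to the rest of `F`. -/
lemma mul_card_le_deficit {W G : κ → Finset ι} {c : ℝ} (U : Finset κ) (hσ : σ ∈ compat R)
    (hW : ∀ s ∈ U, ∀ t ∈ U, s ≠ t → Disjoint (W s) (W t))
    (hnbr : ∀ s ∈ U, ∀ g ∈ G s, ∀ k, R g (σ k) ∨ R k (σ g) → k ∈ W s)
    (hc : ∀ s ∈ U, c ≤ deficit R (G s) σ) (hF : ∀ s ∈ U, F ∩ W s = G s) :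
    c * #U ≤ deficit R F σ := by
  induction U using Finset.induction_on generalizing F with
  | empty => simpa using deficit_nonneg hσ
  | insert s U hs ih =>
    have hGF : G s ⊆ F := hF s (mem_insert_self _ _) ▸ inter_subset_left
    have hFW : ∀ k ∈ F \ G s, k ∉ W s := by
      intro k hk hkW
      rw [mem_sdiff] at hk
      exact hk.2 (hF s (mem_insert_self _ _) ▸ mem_inter.2 ⟨hk.1, hkW⟩)
    have h1 : c * #U ≤ deficit R (F \ G s) σ := by
      refine ih (fun a ha b hb => hW a (mem_insert_of_mem ha) b (mem_insert_of_mem hb))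
        (fun a ha => hnbr a (mem_insert_of_mem ha)) (fun a ha => hc a (mem_insert_of_mem ha)) ?_
      intro t ht
      have hst : s ≠ t := fun h => hs (h ▸ ht)
      have hdis := hW s (mem_insert_self _ _) t (mem_insert_of_mem ht) hst
      rw [← hF t (mem_insert_of_mem ht)]
      ext k
      simp only [mem_inter, mem_sdiff]
      refine ⟨fun h => ⟨h.1.1, h.2⟩, fun h => ⟨⟨h.1, fun hk => ?_⟩, h.2⟩⟩
      rw [← hF s (mem_insert_self _ _)] at hk
      exact disjoint_left.1 hdis (mem_inter.1 hk).2 h.2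
    have h2 := deficit_add_le_deficit_union (G := G s) (H := F \ G s) hσ disjoint_sdiff
      (fun g hg k hk h => hFW k hk (hnbr s (mem_insert_self _ _) g hg k (Or.inl h)))
      (fun k hk g hg h => hFW k hk (hnbr s (mem_insert_self _ _) g hg k (Or.inr h)))
    rw [union_sdiff_of_subset hGF] at h2
    have h3 := hc s (mem_insert_self _ _)
    rw [card_insert_of_notMem hs]
    push_cast
    linarith

lemma two_pow_le_card_inter_eq {W G : Finset ι} (hG : G ⊆ W) :
    2 ^ Fintype.card ι ≤ 2 ^ #W * #{F : Finset ι | F ∩ W = G} := by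
  have h : #(Wᶜ).powerset ≤ #{F : Finset ι | F ∩ W = G} := by
    refine card_le_card_of_injOn (fun H => H ∪ G) ?_ ?_
    · intro H hH
      have hH : Disjoint H W := by
        rw [← subset_compl_iff_disjoint_right]; exact mem_powerset.1 (mem_coe.1 hH)
      simp [union_inter_distrib_right, disjoint_iff_inter_eq_empty.1 hH, inter_eq_left.2 hG]
    · intro H hH H' hH' e
      have key : ∀ K : Finset ι, K ∈ ((Wᶜ).powerset : Set (Finset ι)) → (K ∪ G) \ W = K := by
        intro K hK
        have hK : Disjoint K W := by
          rw [← subset_compl_iff_disjoint_right]; exact mem_powerset.1 (mem_coe.1 hK)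
        rw [union_sdiff_distrib, sdiff_eq_empty_iff_subset.2 hG, union_empty,
          sdiff_eq_self_of_disjoint hK]
      rw [← key H hH, ← key H' hH']
      exact congrArg (· \ W) e
  rw [card_powerset, card_compl] at h
  calc 2 ^ Fintype.card ι = 2 ^ #W * 2 ^ (Fintype.card ι - #W) := by
        rw [← pow_add, Nat.add_sub_cancel' (card_le_univ W)]
    _ ≤ _ := by gcongr

/-- Double count the pairs `(F, s)` with `F ∩ W s = G s`: each `s` occurs for at least a proportion
`2 ^ (-L)` of all `F`. -/
lemma le_sum_deficit {W G : κ → Finset ι} {c : ℝ} {L : ℕ} (T : Finset κ) (hσ : σ ∈ compat R)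
    (hc0 : 0 ≤ c) (hL : ∀ s ∈ T, #(W s) ≤ L)
    (hW : ∀ s ∈ T, ∀ t ∈ T, s ≠ t → Disjoint (W s) (W t)) (hGW : ∀ s ∈ T, G s ⊆ W s)
    (hnbr : ∀ s ∈ T, ∀ g ∈ G s, ∀ k, R g (σ k) ∨ R k (σ g) → k ∈ W s)
    (hc : ∀ s ∈ T, c ≤ deficit R (G s) σ) :
    c * #T * 2 ^ Fintype.card ι ≤ 2 ^ L * ∑ F : Finset ι, deficit R F σ := by
  have h1 : ∀ F : Finset ι, c * #{s ∈ T | F ∩ W s = G s} ≤ deficit R F σ := fun F =>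
    mul_card_le_deficit _ hσ
      (fun s hs t ht => hW s (mem_filter.1 hs).1 t (mem_filter.1 ht).1)
      (fun s hs => hnbr s (mem_filter.1 hs).1) (fun s hs => hc s (mem_filter.1 hs).1)
      (fun s hs => (mem_filter.1 hs).2)
  have h2 : ∑ F : Finset ι, #{s ∈ T | F ∩ W s = G s} =
      ∑ s ∈ T, #{F : Finset ι | F ∩ W s = G s} := by
    simp only [card_filter]
    exact sum_comm
  have h3 : #T * 2 ^ Fintype.card ι ≤ 2 ^ L * ∑ s ∈ T, #{F : Finset ι | F ∩ W s = G s} := by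
    rw [← smul_eq_mul, ← sum_const, mul_sum]
    refine sum_le_sum fun s hs => (two_pow_le_card_inter_eq (hGW s hs)).trans ?_
    gcongr
    · norm_num
    · exact hL s hs
  calc c * #T * 2 ^ Fintype.card ι = c * ((#T * 2 ^ Fintype.card ι : ℕ) : ℝ) := by
        push_cast; ring
    _ ≤ c * ((2 ^ L * ∑ s ∈ T, #{F : Finset ι | F ∩ W s = G s} : ℕ) : ℝ) := by
        gcongr
    _ = 2 ^ L * ∑ F : Finset ι, c * #{s ∈ T | F ∩ W s = G s} := by
        rw [← h2, ← mul_sum]; push_cast; ring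
    _ ≤ _ := by
        gcongr with F
        exact h1 F

/-! ### The two defective patterns -/

/-- A lower bound for the deficit of the two smallest connected patterns which are not all-ones
blocks. -/
noncomputable def gap : ℝ := min (Real.log 2 / 2) (Real.log 2 + Real.log 6 / 3 - Real.log 3)

lemma gap_pos : 0 < gap := by
  have h2 : 0 < Real.log 2 := Real.log_pos (by norm_num)
  refine lt_min (by linarith) ?_
  have h6 : Real.log 6 = Real.log 2 + Real.log 3 := by
    rw [← Real.log_mul (by norm_num) (by norm_num)]; norm_num
  have h3 : Real.log 3 * 2 < Real.log 2 * 4 := by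
    have : Real.log (3 ^ 2) < Real.log (2 ^ 4) := Real.log_lt_log (by norm_num) (by norm_num)
    rw [Real.log_pow, Real.log_pow] at this
    push_cast at this
    linarith
  linarith

lemma gap_le_deficit_pair (hσ : σ ∈ compat R) {i k : ι} (hik : R i (σ k)) (hki : ¬ R k (σ i)) :
    gap ≤ deficit R {i, k} σ := by
  have hi := mem_compat.1 hσ i
  have hk := mem_compat.1 hσ k
  have hne : i ≠ k := by rintro rfl; exact hki hik
  have a1 : avail R {i, k} σ i = 2 := by
    simp [avail, filter_insert, filter_singleton, hi, hik, hne]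
  have a2 : avail R {i, k} σ k = 1 := by
    simp [avail, filter_insert, filter_singleton, hk, hki]
  have hB : ∑ j ∈ {i, k}, phi (avail R {i, k} σ j) = Real.log 2 / 2 := by
    rw [sum_pair hne, a1, a2]; simp [phi]
  -- The class is not enumerated: Brègman's inequality puts its size below 2, and integrality makes
  -- it at most 1. For the triple the same argument turns "below 4" into "at most 3".
  have h0 := deficit_nonneg (F := {i, k}) hσ
  rw [deficit, hB] at h0 ⊢
  have hpos : (0 : ℝ) < #(cls R {i, k} σ) := by exact_mod_cast card_cls_pos hσ
  have h2 : 0 < Real.log 2 := Real.log_pos (by norm_num)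
  have hlt : (#(cls R {i, k} σ) : ℝ) < 2 :=
    (Real.log_lt_log_iff hpos (by norm_num)).1 (by linarith)
  have hle : (#(cls R {i, k} σ) : ℝ) ≤ 1 := by
    have : #(cls R {i, k} σ) < 2 := by exact_mod_cast hlt
    exact_mod_cast Nat.lt_succ_iff.1 this
  have := Real.log_nonpos hpos.le hle
  have := min_le_left (Real.log 2 / 2) (Real.log 2 + Real.log 6 / 3 - Real.log 3)
  rw [gap]
  linarith

lemma gap_le_deficit_triple (hσ : σ ∈ compat R) {i j k : ι} (hij : R i (σ j)) (hji : R j (σ i))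
    (hjk : R j (σ k)) (hkj : R k (σ j)) (hik : ¬ R i (σ k)) (hki : ¬ R k (σ i)) :
    gap ≤ deficit R {i, j, k} σ := by
  have hi := mem_compat.1 hσ i
  have hj := mem_compat.1 hσ j
  have hk := mem_compat.1 hσ k
  have n1 : i ≠ j := by rintro rfl; exact hik hjk
  have n2 : i ≠ k := by rintro rfl; exact hik hi
  have n3 : j ≠ k := by rintro rfl; exact hki hji
  have a1 : avail R {i, j, k} σ i = 2 := by
    simp [avail, filter_insert, filter_singleton, hi, hij, hik, n1]
  have a2 : avail R {i, j, k} σ j = 3 := by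
    simp [avail, filter_insert, filter_singleton, hj, hji, hjk, n1, n2, n3]
  have a3 : avail R {i, j, k} σ k = 2 := by
    simp [avail, filter_insert, filter_singleton, hk, hki, hkj, n3]
  have hB : ∑ l ∈ {i, j, k}, phi (avail R {i, j, k} σ l) = Real.log 2 + Real.log 6 / 3 := by
    rw [sum_insert (by simp [n1, n2]), sum_pair n3, a1, a2, a3]
    simp [phi, Nat.factorial]
    ring
  have h0 := deficit_nonneg (F := {i, j, k}) hσ
  rw [deficit, hB] at h0 ⊢
  have hpos : (0 : ℝ) < #(cls R {i, j, k} σ) := by exact_mod_cast card_cls_pos hσ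
  have h6 : Real.log 6 < 3 * Real.log 2 := by
    have : Real.log 6 < Real.log (2 ^ 3) := Real.log_lt_log (by norm_num) (by norm_num)
    rwa [Real.log_pow] at this
  have h4 : Real.log 4 = 2 * Real.log 2 := by
    rw [show (4 : ℝ) = 2 ^ 2 by norm_num, Real.log_pow]; norm_num
  have hlt : (#(cls R {i, j, k} σ) : ℝ) < 4 :=
    (Real.log_lt_log_iff hpos (by norm_num)).1 (by linarith)
  have hle : (#(cls R {i, j, k} σ) : ℝ) ≤ 3 := by
    have : #(cls R {i, j, k} σ) < 4 := by exact_mod_cast hlt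
    exact_mod_cast Nat.lt_succ_iff.1 this
  have := Real.log_le_log hpos hle
  have := min_le_right (Real.log 2 / 2) (Real.log 2 + Real.log 6 / 3 - Real.log 3)
  rw [gap]
  linarith

end Bregman

/-! ### Stability for relations with short rows and no block -/

namespace Bregman

variable {n d : ℕ} {R : Fin n → Fin n → Prop} [DecidableRel R] {σ : Equiv.Perm (Fin n)}

/-- Some `d` rows have the same support, which no other row meets. -/
def HasBlock (R : Fin n → Fin n → Prop) [DecidableRel R] (d : ℕ) : Prop :=
  ∃ i₀, #{i | ∀ j, R i j ↔ R i₀ j} = d ∧ ∀ i j, R i₀ j → R i j → ∀ j', R i j' ↔ R i₀ j'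

lemma card_filter_comp_perm (P : Fin n → Prop) [DecidablePred P] (σ : Equiv.Perm (Fin n)) :
    #{i | P (σ i)} = #{j | P j} := by
  rw [← card_map σ.toEmbedding]
  congr 1
  ext j
  simp only [mem_map_equiv, mem_filter, mem_univ, true_and, Equiv.apply_symm_apply]

/-- If no pair or triple near `p` is defective, then `R i (σ k)` is symmetric and transitive in `i`,
`k` near `p`, and the row paired with `p` lies in a block. The radius is `2 * d` because rows
meeting that block's columns must be controlled as well. -/
lemma exists_gap_le_deficit (hcard : ∀ i, #{j | R i j} = d)
    (hloc : ∀ i a b, R i a → R i b → (a : ℕ) < b + d) (hR : ¬ HasBlock R d)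
    (hσ : σ ∈ compat R) (p : Fin n) :
    ∃ G : Finset (Fin n), (∀ g ∈ G, (σ g : ℕ) < p + 2 * d ∧ (p : ℕ) < σ g + 2 * d) ∧
      gap ≤ deficit R G σ := by
  by_contra! hG
  have hself := mem_compat.1 hσ
  have hsymm : ∀ i k, ((σ i : ℕ) < p + 2 * d ∧ (p : ℕ) < σ i + 2 * d) →
      ((σ k : ℕ) < p + 2 * d ∧ (p : ℕ) < σ k + 2 * d) → R i (σ k) → R k (σ i) := by
    intro i k hi hk hik
    by_contra hki
    refine absurd (gap_le_deficit_pair hσ hik hki) (not_le.2 (hG _ ?_))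
    simp only [mem_insert, mem_singleton]
    rintro g (rfl | rfl) <;> assumption
  have htrans : ∀ i j k, ((σ i : ℕ) < p + 2 * d ∧ (p : ℕ) < σ i + 2 * d) →
      ((σ j : ℕ) < p + 2 * d ∧ (p : ℕ) < σ j + 2 * d) →
      ((σ k : ℕ) < p + 2 * d ∧ (p : ℕ) < σ k + 2 * d) → R i (σ j) → R j (σ k) → R i (σ k) := by
    intro i j k hi hj hk hij hjk
    by_contra hik
    refine absurd (gap_le_deficit_triple hσ hij (hsymm i j hi hj hij) hjk (hsymm j k hj hk hjk)
      hik fun h => hik (hsymm k i hk hi h)) (not_le.2 (hG _ ?_))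
    simp only [mem_insert, mem_singleton]
    rintro g (rfl | rfl | rfl) <;> assumption
  obtain ⟨i₀, hi₀⟩ : ∃ i₀, σ i₀ = p := σ.surjective p
  subst hi₀
  have hd : 0 < d := by
    have := hloc i₀ _ _ (hself i₀) (hself i₀)
    omega
  have hnear : ∀ k, R i₀ (σ k) → ((σ k : ℕ) < σ i₀ + 2 * d ∧ (σ i₀ : ℕ) < σ k + 2 * d) := by
    intro k hk
    have h1 := hloc i₀ _ _ hk (hself i₀)
    have h2 := hloc i₀ _ _ (hself i₀) hk
    omega
  have hsupp : ∀ k, R i₀ (σ k) → ∀ j, R k j ↔ R i₀ j := by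
    intro k hk
    have hsub : (univ.filter fun j => R i₀ j) ⊆ univ.filter fun j => R k j := by
      intro j hj
      obtain ⟨m, rfl⟩ := σ.surjective j
      simp only [mem_filter, mem_univ, true_and] at hj ⊢
      exact htrans k i₀ m (hnear k hk) (by omega) (hnear m hj)
        (hsymm i₀ k (by omega) (hnear k hk) hk) hj
    have heq := eq_of_subset_of_card_le hsub (by rw [hcard, hcard])
    intro j
    have := congrArg (j ∈ ·) heq
    simpa using this.symm
  refine hR ⟨i₀, ?_, ?_⟩
  · rw [← hcard i₀, ← card_filter_comp_perm (fun j => R i₀ j) σ]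
    congr 1
    ext i
    simp only [mem_filter, mem_univ, true_and]
    exact ⟨fun h => (h _).1 (hself i), hsupp i⟩
  · intro i j hj hij
    obtain ⟨k, rfl⟩ := σ.surjective j
    have h1 := hloc i₀ _ _ hj (hself i₀)
    have h2 := hloc i₀ _ _ (hself i₀) hj
    have h3 := hloc i _ _ hij (hself i)
    have h4 := hloc i _ _ (hself i) hij
    have hki := hsymm i k (by omega) (hnear k hj) hij
    exact hsupp i ((hsupp k hj _).1 hki)

lemma sum_deficit_univ (hcard : ∀ i, #{j | R i j} = d) :
    ∑ σ ∈ compat R, deficit R univ σ =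
      #(compat R) * (n * phi d - Real.log #(compat R)) := by
  have : ∀ σ ∈ compat R, deficit R univ σ = n * phi d - Real.log #(compat R) := by
    intro σ _
    have hc : cls R univ σ = compat R := by simp [cls]
    have ha : ∀ i, avail R univ σ i = d := fun i => by
      rw [avail, card_filter_comp_perm (fun j => R i j) σ, hcard]
    simp [deficit, hc, ha]
  rw [sum_congr rfl this, sum_const, nsmul_eq_mul]

lemma card_filter_div_eq_le (L s : ℕ) (hL : 0 < L) (σ : Equiv.Perm (Fin n)) :
    #{k : Fin n | (σ k : ℕ) / L = s} ≤ L := by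
  have h : #{k : Fin n | (σ k : ℕ) / L = s} ≤ #(Ico (L * s) (L * s + L)) := by
    refine card_le_card_of_injOn (fun k => (σ k : ℕ)) ?_ ?_
    · intro k hk
      simp only [coe_filter, mem_univ, true_and, Set.mem_ofPred_eq] at hk
      have h1 := Nat.div_add_mod (σ k : ℕ) L
      have h2 := Nat.mod_lt (σ k : ℕ) hL
      rw [hk] at h1
      simp only [coe_Ico, Set.mem_Ico]
      omega
    · intro a _ b _ h
      exact σ.injective (Fin.ext h)
  simpa using h

/-- A relation with row sums `d`, local and without blocks, has far fewer compatible permutations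
than Brègman's inequality allows. -/
theorem gap_mul_le (hd : 0 < d) (hcard : ∀ i, #{j | R i j} = d)
    (hloc : ∀ i a b, R i a → R i b → (a : ℕ) < b + d) (hR : ¬ HasBlock R d)
    (hne : (compat R).Nonempty) :
    gap * (n / (7 * d) : ℕ) ≤ 2 ^ (7 * d) * (n * phi d - Real.log #(compat R)) := by
  have hpos : (0 : ℝ) < #(compat R) := by exact_mod_cast card_pos.2 hne
  have key : ∀ σ ∈ compat R, gap * (n / (7 * d) : ℕ) * 2 ^ n ≤
      2 ^ (7 * d) * ∑ F : Finset (Fin n), deficit R F σ := by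
    intro σ hσ
    have hself := mem_compat.1 hσ
    have hwin : ∀ s, s ∈ range (n / (7 * d)) → ∃ G : Finset (Fin n),
        (∀ g ∈ G, (σ g : ℕ) < 7 * d * s + 5 * d ∧ 7 * d * s + d < σ g) ∧
        gap ≤ deficit R G σ := by
      intro s hs
      have hs : s + 1 ≤ n / (7 * d) := mem_range.1 hs
      have h1 : 7 * d * (s + 1) ≤ n :=
        (Nat.mul_le_mul_left _ hs).trans (Nat.mul_div_le _ _)
      -- Centring at offset `3 * d` keeps `G` between offsets `d` and `5 * d`, so all neighbours of
      -- `G` stay in the same window of length `7 * d`.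
      obtain ⟨G, hG, hG'⟩ := exists_gap_le_deficit hcard hloc hR hσ
        ⟨7 * d * s + 3 * d, by rw [mul_add] at h1; omega⟩
      refine ⟨G, fun g hg => ?_, hG'⟩
      have := hG g hg
      simp only at this
      omega
    choose! G hG hG' using hwin
    have hdiv : ∀ s (k : Fin n), 7 * d * s ≤ (σ k : ℕ) → (σ k : ℕ) < 7 * d * s + 7 * d →
        (σ k : ℕ) / (7 * d) = s := fun s k h1 h2 =>
      Nat.div_eq_of_lt_le (by rw [mul_comm]; exact h1) (by rw [mul_comm, mul_add]; omega)
    have h := le_sum_deficit (R := R) (σ := σ) (c := gap) (L := 7 * d) (range (n / (7 * d)))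
      (W := fun s => univ.filter fun k : Fin n => (σ k : ℕ) / (7 * d) = s) (G := G) hσ
      gap_pos.le (fun s _ => card_filter_div_eq_le _ _ (by omega) σ)
      (fun s _ t _ hst => disjoint_filter.2 fun k _ h1 h2 => hst (h1.symm.trans h2))
      (fun s hs g hg => mem_filter.2 ⟨mem_univ _, by
        have := hG s hs g hg
        exact hdiv s g (by omega) (by omega)⟩)
      (fun s hs g hg k hk => mem_filter.2 ⟨mem_univ _, by
        have h0 := hG s hs g hg
        have h1 : (σ k : ℕ) < σ g + d ∧ (σ g : ℕ) < σ k + d := by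
          rcases hk with hk | hk
          · exact ⟨hloc g _ _ hk (hself g), hloc g _ _ (hself g) hk⟩
          · exact ⟨hloc k _ _ (hself k) hk, hloc k _ _ hk (hself k)⟩
        exact hdiv s k (by omega) (by omega)⟩)
      hG'
    simpa using h
  have h1 := sum_le_sum key
  rw [sum_const, nsmul_eq_mul, ← mul_sum, sum_comm] at h1
  have h2 := sum_deficit_le (R := R)
  rw [sum_deficit_univ hcard, Fintype.card_fin] at h2
  have h3 : (2 : ℝ) ^ (7 * d) * ∑ F : Finset (Fin n), ∑ σ ∈ compat R, deficit R F σ ≤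
      2 ^ (7 * d) * (2 ^ n * (#(compat R) * (n * phi d - Real.log #(compat R)))) := by gcongr
  have h4 : (0 : ℝ) < #(compat R) * 2 ^ n := by positivity
  refine le_of_mul_le_mul_left ?_ h4
  linarith

end Bregman

/-! ### Permanents, direct sums and membership in `Gam` -/

namespace Matrix

lemma permanent_submatrix_equiv {m n α : Type*} [Fintype m] [DecidableEq m] [Fintype n]
    [DecidableEq n] [CommSemiring α] (A : Matrix n n α) (e f : m ≃ n) :
    (A.submatrix e f).permanent = A.permanent := by
  refine Fintype.sum_equiv (Equiv.equivCongr f e) _ _ fun σ => ?_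
  refine Fintype.prod_equiv f _ _ fun i => ?_
  simp

lemma permanent_fromBlocks_zero {m n α : Type*} [Fintype m] [DecidableEq m] [Fintype n]
    [DecidableEq n] [CommSemiring α] (A : Matrix m m α) (D : Matrix n n α) :
    (fromBlocks A 0 0 D).permanent = A.permanent * D.permanent := by
  rw [permanent, permanent, permanent, sum_mul_sum, ← sum_product', univ_product_univ]
  symm
  refine sum_of_injOn (fun σ => σ.1.sumCongr σ.2) ?_ (fun _ _ => by simp) ?_ ?_
  · intro σ _ τ _ h
    have h2 := DFunLike.congr_fun h
    simp only [Equiv.sumCongr_apply, Sum.forall, Sum.map_inl, Sum.map_inr, Sum.inl.injEq,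
      Sum.inr.injEq] at h2
    exact Prod.ext (Equiv.ext h2.1) (Equiv.ext h2.2)
  · intro σ _ hσ
    -- A permutation preserving the left summand splits as a sum of two; any other one meets a zero
    -- block.
    have h1 : ¬ Set.MapsTo σ (Set.range Sum.inl) (Set.range Sum.inl) := by
      intro h
      obtain ⟨τ, hτ⟩ := Equiv.Perm.mem_sumCongrHom_range_of_perm_mapsTo_inl h
      exact hσ ⟨τ, by simp, hτ⟩
    simp only [Set.MapsTo, Set.mem_range, forall_exists_index, forall_apply_eq_imp_iff,
      not_forall] at h1
    obtain ⟨a, ha⟩ := h1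
    refine prod_eq_zero (mem_univ (Sum.inl a)) ?_
    rcases hx : σ (Sum.inl a) with b | b
    · exact absurd ⟨b, hx.symm⟩ ha
    · simp
  · intro σ _
    simp [Fintype.prod_sum_type]

end Matrix

lemma permanent_directSum {m n : ℕ} (A : Matrix (Fin m) (Fin m) ℕ) (B : Matrix (Fin n) (Fin n) ℕ) :
    (directSum A B).permanent = A.permanent * B.permanent := by
  rw [directSum, Matrix.reindex_apply, Matrix.permanent_submatrix_equiv,
    Matrix.permanent_fromBlocks_zero]

lemma permanent_allOnes (d : ℕ) : (allOnes d).permanent = d.factorial := by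
  simp [Matrix.permanent, allOnes, Fintype.card_perm]

/-- The relation given by the non-zero entries of a matrix. -/
abbrev support {n : ℕ} (A : Matrix (Fin n) (Fin n) ℕ) (i j : Fin n) : Prop := A i j ≠ 0

instance {n : ℕ} (A : Matrix (Fin n) (Fin n) ℕ) : DecidableRel (support A) := fun i j =>
  inferInstanceAs (Decidable (A i j ≠ 0))

lemma permanent_eq_card_compat {n : ℕ} {A : Matrix (Fin n) (Fin n) ℕ}
    (hA : ∀ i j, A i j = 0 ∨ A i j = 1) :
    A.permanent = #(Bregman.compat (support A)) := by
  -- `Matrix.permanent` multiplies the entries `A (σ i) i`, whereas `compat` tests `R i (σ i)`.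
  rw [← Matrix.permanent_transpose, Matrix.permanent, Bregman.compat, card_filter]
  refine sum_congr rfl fun σ _ => ?_
  simp only [Matrix.transpose_apply]
  split_ifs with h
  · exact prod_eq_one fun i _ => (hA i (σ i)).resolve_left (h i)
  · push Not at h
    obtain ⟨i, hi⟩ := h
    exact prod_eq_zero (mem_univ i) hi

lemma card_filter_comp_of_range {m n : ℕ} (f : Fin m ↪ Fin n) (P : Fin n → Prop) [DecidablePred P]
    (h : ∀ j, P j → ∃ k, f k = j) : #{k | P (f k)} = #{j | P j} := by
  rw [← card_map f]
  congr 1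
  ext j
  simp only [mem_map, mem_filter, mem_univ, true_and]
  constructor
  · rintro ⟨k, hk, rfl⟩
    exact hk
  · intro hj
    obtain ⟨k, rfl⟩ := h j hj
    exact ⟨k, hj, rfl⟩

section DirectSum

variable {m n : ℕ} (A : Matrix (Fin m) (Fin m) ℕ) (B : Matrix (Fin n) (Fin n) ℕ)

@[simp] lemma directSum_castAdd_castAdd (i j : Fin m) :
    directSum A B (Fin.castAdd n i) (Fin.castAdd n j) = A i j := by
  simp [directSum]

@[simp] lemma directSum_castAdd_natAdd (i : Fin m) (j : Fin n) :
    directSum A B (Fin.castAdd n i) (Fin.natAdd m j) = 0 := by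
  simp [directSum]

@[simp] lemma directSum_natAdd_castAdd (i : Fin n) (j : Fin m) :
    directSum A B (Fin.natAdd m i) (Fin.castAdd n j) = 0 := by
  simp [directSum]

@[simp] lemma directSum_natAdd_natAdd (i j : Fin n) :
    directSum A B (Fin.natAdd m i) (Fin.natAdd m j) = B i j := by
  simp [directSum]

variable {A B}

lemma card_directSum_castAdd (i : Fin m) :
    #{j | directSum A B (Fin.castAdd n i) j ≠ 0} = #{j | A i j ≠ 0} := by
  rw [← card_filter_comp_of_range (Fin.castAddEmb n)]
  · simp
  · intro j
    induction j using Fin.addCases <;> simp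

lemma card_directSum_natAdd (i : Fin n) :
    #{j | directSum A B (Fin.natAdd m i) j ≠ 0} = #{j | B i j ≠ 0} := by
  rw [← card_filter_comp_of_range (Fin.natAddEmb m)]
  · simp
  · intro j
    induction j using Fin.addCases <;> simp

lemma ordConnected_directSum_castAdd (i : Fin m) :
    {j | directSum A B (Fin.castAdd n i) j ≠ 0}.OrdConnected ↔ {j | A i j ≠ 0}.OrdConnected := by
  constructor
  · intro h
    have := h.preimage_mono (Fin.strictMono_castAdd n).monotone
    simpa [Set.preimage] using this
  · intro h
    refine ⟨fun a ha b hb x hx => ?_⟩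
    induction a using Fin.addCases with
    | right a => simp at ha
    | left a =>
    induction b using Fin.addCases with
    | right b => simp at hb
    | left b =>
    induction x using Fin.addCases with
    | right x =>
      have := hx.2
      rw [Fin.le_def] at this
      simp at this
      omega
    | left x =>
    have hx' : x ∈ Set.Icc a b := hx
    simpa using h.out (by simpa using ha) (by simpa using hb) hx'

lemma ordConnected_directSum_natAdd (i : Fin n) (h : {j | B i j ≠ 0}.OrdConnected) :
    {j | directSum A B (Fin.natAdd m i) j ≠ 0}.OrdConnected := by
  refine ⟨fun a ha b hb x hx => ?_⟩
  induction a using Fin.addCases with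
  | left a => simp at ha
  | right a =>
  induction b using Fin.addCases with
  | left b => simp at hb
  | right b =>
  induction x using Fin.addCases with
  | left x =>
    have := hx.1
    rw [Fin.le_def] at this
    simp at this
    omega
  | right x =>
  have hx' : x ∈ Set.Icc a b := by simpa using hx
  simpa using h.out (by simpa using ha) (by simpa using hb) hx'

lemma directSum_allOnes_mem_Gam_iff {d : ℕ} :
    directSum A (allOnes d) ∈ Gam (m + d) d ↔ A ∈ Gam m d := by
  constructor
  · rintro ⟨h1, h2⟩
    refine ⟨fun i j => by simpa using h1 (Fin.castAdd d i) (Fin.castAdd d j), fun i => ?_⟩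
    have := h2 (Fin.castAdd d i)
    rwa [card_directSum_castAdd, ordConnected_directSum_castAdd] at this
  · rintro ⟨h1, h2⟩
    refine ⟨fun i j => ?_, fun i => ?_⟩
    · induction i using Fin.addCases <;> induction j using Fin.addCases <;> simp [h1]
      simp [allOnes]
    · induction i using Fin.addCases with
      | left i =>
        rw [card_directSum_castAdd, ordConnected_directSum_castAdd]
        exact h2 i
      | right i =>
        rw [card_directSum_natAdd]
        refine ⟨by simp [allOnes], ordConnected_directSum_natAdd i ?_⟩
        simpa [allOnes] using Set.ordConnected_univ

end DirectSum

/-! ### Comparison of matrices with and without a block -/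

lemma lt_add_of_mem_Gam {n d : ℕ} {A : Matrix (Fin n) (Fin n) ℕ} (hA : A ∈ Gam n d)
    {i a b : Fin n} (ha : A i a ≠ 0) (hb : A i b ≠ 0) : (a : ℕ) < b + d := by
  by_contra! h
  obtain ⟨h1, h2⟩ := hA.2 i
  have hsub : Icc b a ⊆ univ.filter fun j => A i j ≠ 0 := fun x hx =>
    mem_filter.2 ⟨mem_univ _, h2.out hb ha (by simpa using hx)⟩
  have := card_le_card hsub
  rw [h1, Fin.card_Icc] at this
  omega

lemma exists_mem_Gam_permanent_pos {n d : ℕ} (hd : 0 < d) (hn : d ≤ n) :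
    ∃ A ∈ Gam n d, 0 < A.permanent := by
  -- Row `i` starts at `s i`: it fits into `n` columns and covers the diagonal, so the identity is
  -- compatible.
  let s : Fin n → ℕ := fun i => min i (n - d)
  let A : Matrix (Fin n) (Fin n) ℕ := fun i j => if s i ≤ j ∧ (j : ℕ) < s i + d then 1 else 0
  have h01 : ∀ i j, A i j = 0 ∨ A i j = 1 := fun i j => by
    simp only [A]; split_ifs <;> simp
  refine ⟨A, ⟨h01, fun i => ⟨?_, ?_⟩⟩, ?_⟩
  · have : (univ.filter fun j => A i j ≠ 0).map Fin.valEmbedding = Ico (s i) (s i + d) := by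
      ext x
      simp only [mem_map, mem_filter, mem_univ, true_and, Fin.valEmbedding_apply, mem_Ico, A]
      constructor
      · rintro ⟨j, hj, rfl⟩
        simpa using hj
      · intro hx
        have : s i ≤ n - d := min_le_right _ _
        exact ⟨⟨x, by omega⟩, by simpa using hx, rfl⟩
    rw [← card_map Fin.valEmbedding, this]
    simp
  · refine ⟨fun a ha b hb x hx => ?_⟩
    simp only [ne_eq, ite_eq_right_iff, one_ne_zero, imp_false, not_not, Set.mem_ofPred_eq,
      Set.mem_Icc, Fin.le_def, A] at *
    omega
  · rw [permanent_eq_card_compat h01, card_pos]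
    refine ⟨1, Bregman.mem_compat.2 fun i => ?_⟩
    have := i.isLt
    have hs : s i = min (i : ℕ) (n - d) := rfl
    simp only [Equiv.Perm.coe_one, id_eq, ne_eq, ite_eq_right_iff, one_ne_zero, imp_false,
      not_not, A]
    omega

/-- Split off `k` all-ones blocks; the remainder has order at least `d`, so it can be given a
positive permanent. -/
lemma exists_mem_Gam_le_permanent {d : ℕ} (hd : 0 < d) (k : ℕ) {n : ℕ} (hn : (k + 1) * d ≤ n) :
    ∃ A ∈ Gam n d, d.factorial ^ k ≤ A.permanent := by
  induction k generalizing n with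
  | zero => simpa [Nat.one_le_iff_ne_zero, Nat.pos_iff_ne_zero] using exists_mem_Gam_permanent_pos hd (by simpa using hn)
  | succ k ih =>
    obtain ⟨m, rfl⟩ : ∃ m, n = m + d := ⟨n - d, by rw [add_mul] at hn; omega⟩
    obtain ⟨A, hA, hle⟩ := ih (n := m) (by rw [add_mul (k + 1)] at hn; omega)
    refine ⟨directSum A (allOnes d), directSum_allOnes_mem_Gam_iff.2 hA, ?_⟩
    rw [permanent_directSum, permanent_allOnes, pow_succ]
    gcongr

/-- The other rows vanish on the block's columns, so deleting these columns in order keeps all their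
ones, still consecutive. -/
lemma exists_permanent_eq_of_hasBlock {n d : ℕ} {A : Matrix (Fin (n + d)) (Fin (n + d)) ℕ}
    (hA : A ∈ Gam (n + d) d) (h : Bregman.HasBlock (support A) d) :
    ∃ B ∈ Gam n d, A.permanent = B.permanent * d.factorial := by
  obtain ⟨i₀, hrows, hmeet⟩ := h
  let rows : Finset (Fin (n + d)) := univ.filter fun i => ∀ j, A i j ≠ 0 ↔ A i₀ j ≠ 0
  let cols : Finset (Fin (n + d)) := univ.filter fun j => A i₀ j ≠ 0
  have hcols : #cols = d := (hA.2 i₀).1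
  have hrows : #rows = d := hrows
  have hrc : #rowsᶜ = n := by rw [card_compl, hrows]; simp
  have hcc : #colsᶜ = n := by rw [card_compl, hcols]; simp
  let e : Fin n ⊕ Fin d ≃ Fin (n + d) := finSumEquivOfFinset hrc (by rwa [compl_compl])
  let f : Fin n ⊕ Fin d ≃ Fin (n + d) := finSumEquivOfFinset hcc (by rwa [compl_compl])
  have he1 : ∀ i, e (Sum.inl i) ∉ rows := fun i => by
    rw [← mem_compl]; simp only [e, finSumEquivOfFinset_inl]; exact orderEmbOfFin_mem _ _ _
  have he2 : ∀ i, e (Sum.inr i) ∈ rows := fun i => by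
    rw [← compl_compl rows]; simp only [e, finSumEquivOfFinset_inr]; exact orderEmbOfFin_mem _ _ _
  have hf1 : ∀ i, f (Sum.inl i) ∉ cols := fun i => by
    rw [← mem_compl]; simp only [f, finSumEquivOfFinset_inl]; exact orderEmbOfFin_mem _ _ _
  have hf2 : ∀ i, f (Sum.inr i) ∈ cols := fun i => by
    rw [← compl_compl cols]; simp only [f, finSumEquivOfFinset_inr]; exact orderEmbOfFin_mem _ _ _
  have hzero : ∀ i ∉ rows, ∀ j ∈ cols, A i j = 0 := by
    intro i hi j hj
    by_contra h0
    exact hi (mem_filter.2 ⟨mem_univ _, hmeet i j (mem_filter.1 hj).2 h0⟩)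
  let B : Matrix (Fin n) (Fin n) ℕ := fun i j => A (e (Sum.inl i)) (f (Sum.inl j))
  have hblocks : A.submatrix e f = Matrix.fromBlocks B 0 0 (allOnes d) := by
    ext (i | i) (j | j)
    · rfl
    · exact hzero _ (he1 i) _ (hf2 j)
    · by_contra h0
      exact hf1 j (mem_filter.2 ⟨mem_univ _, ((mem_filter.1 (he2 i)).2 _).1 h0⟩)
    · exact (hA.1 _ _).resolve_left
        (((mem_filter.1 (he2 i)).2 _).2 (mem_filter.1 (hf2 j)).2)
  refine ⟨B, ⟨fun i j => hA.1 _ _, fun i => ?_⟩, ?_⟩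
  · obtain ⟨h1, h2⟩ := hA.2 (e (Sum.inl i))
    constructor
    · rw [← h1]
      refine card_filter_comp_of_range (Function.Embedding.inl.trans f.toEmbedding)
        (fun j => A (e (Sum.inl i)) j ≠ 0) fun j hj => ?_
      obtain ⟨k | k, rfl⟩ := f.surjective j
      · exact ⟨k, rfl⟩
      · exact absurd (hzero _ (he1 i) _ (hf2 k)) hj
    · have hmono : Monotone fun j : Fin n => f (Sum.inl j) := by
        intro a b hab
        simp only [f, finSumEquivOfFinset_inl]
        exact (orderEmbOfFin _ _).monotone hab
      exact h2.preimage_mono hmono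
  · rw [← Matrix.permanent_submatrix_equiv A e f, hblocks, Matrix.permanent_fromBlocks_zero,
      permanent_allOnes]

/-- In large order, a matrix without all-ones block is no better than a direct sum of all-ones
blocks and a remainder. -/
lemma exists_permanent_le_of_not_hasBlock {d : ℕ} (hd : 0 < d) :
    ∃ μ : ℕ, ∀ n, μ ≤ n → d ≤ n ∧ ∀ B ∈ Gam (n + d) d,
      ¬ Bregman.HasBlock (support B) d →
      B.permanent ≤ d.factorial ^ (n / d) := by
  -- The loss must reach `2 * log d!`: one `log d!` for the order `n + d` instead of `n`, one for
  -- rounding down in `n / d`.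
  obtain ⟨K, hK⟩ := exists_nat_ge (2 * Real.log d.factorial * 2 ^ (7 * d) / Bregman.gap)
  refine ⟨7 * d * (K + 1), fun n hn => ⟨by nlinarith, fun B hB hblock => ?_⟩⟩
  rw [permanent_eq_card_compat hB.1]
  rcases (Bregman.compat (support B)).eq_empty_or_nonempty with h0 | hne
  · rw [h0]; simp
  have hbound := Bregman.gap_mul_le hd (fun i => (hB.2 i).1)
    (fun i a b ha hb => lt_add_of_mem_Gam hB ha hb) hblock hne
  set N := #(Bregman.compat (support B)) with hN
  have hNpos : (0 : ℝ) < N := by exact_mod_cast card_pos.2 hne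
  have hfac : (1 : ℝ) ≤ d.factorial := by exact_mod_cast d.factorial_pos
  have hl0 : 0 ≤ Real.log d.factorial := Real.log_nonneg hfac
  have hdR : (0 : ℝ) < d := by exact_mod_cast hd
  have hKn : K ≤ (n + d) / (7 * d) := by
    rw [Nat.le_div_iff_mul_le (by omega)]
    nlinarith
  have h1 : 2 * Real.log d.factorial * 2 ^ (7 * d) ≤
      Bregman.gap * ((n + d) / (7 * d) : ℕ) := by
    rw [div_le_iff₀ Bregman.gap_pos] at hK
    have : (K : ℝ) ≤ ((n + d) / (7 * d) : ℕ) := by exact_mod_cast hKn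
    nlinarith [Bregman.gap_pos]
  have h2 : 2 * Real.log d.factorial ≤ ((n + d : ℕ) : ℝ) * Bregman.phi d - Real.log N := by
    refine le_of_mul_le_mul_left ?_ (show (0 : ℝ) < 2 ^ (7 * d) by positivity)
    linarith
  have h3 : ((n + d : ℕ) : ℝ) * Bregman.phi d ≤ ((n / d : ℕ) + 2) * Real.log d.factorial := by
    have h4 : ((n + d : ℕ) : ℝ) ≤ ((n / d : ℕ) + 2) * d := by
      have h5 : n + d ≤ (n / d + 2) * d := by
        have := Nat.div_add_mod n d
        have := Nat.mod_lt n hd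
        nlinarith
      exact_mod_cast h5
    have hphi : 0 ≤ Bregman.phi d := div_nonneg hl0 hdR.le
    rw [← Bregman.natCast_mul_phi]
    nlinarith
  have h6 : Real.log N ≤ Real.log ((d.factorial : ℝ) ^ (n / d)) := by
    rw [Real.log_pow]; linarith
  have h7 := (Real.log_le_log_iff hNpos (by positivity)).1 h6
  exact_mod_cast h7

theorem theorem3p8 (d : ℕ) (hd : 0 < d) :
    ∃ μ : ℕ, ∀ n : ℕ, μ ≤ n → ∀ A : Matrix (Fin n) (Fin n) ℕ,
      A ∈ MaxPer n d ↔ directSum A (allOnes d) ∈ MaxPer (n + d) d := by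
  obtain ⟨μ, hμ⟩ := exists_permanent_le_of_not_hasBlock hd
  refine ⟨μ, fun n hn A => ?_⟩
  obtain ⟨hdn, hno⟩ := hμ n hn
  constructor
  · rintro ⟨hA, hmax⟩
    refine ⟨directSum_allOnes_mem_Gam_iff.2 hA, fun B hB => ?_⟩
    rw [permanent_directSum, permanent_allOnes]
    by_cases hblock : Bregman.HasBlock (support B) d
    · obtain ⟨C, hC, hBC⟩ := exists_permanent_eq_of_hasBlock hB hblock
      rw [hBC]
      exact Nat.mul_le_mul_right _ (hmax C hC)
    -- One of the `n / d` factors `d!` is matched by the appended block; `A` has to supply only the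
    -- other `k`.
    · obtain ⟨k, hk⟩ : ∃ k, n / d = k + 1 :=
        ⟨n / d - 1, by have := Nat.div_pos hdn hd; omega⟩
      obtain ⟨C, hC, hle⟩ := exists_mem_Gam_le_permanent hd k (n := n)
        (by rw [← hk]; exact Nat.div_mul_le_self n d)
      refine (hno B hB hblock).trans ?_
      rw [hk, pow_succ]
      exact Nat.mul_le_mul_right _ (hle.trans (hmax C hC))
  · rintro ⟨hA, hmax⟩
    refine ⟨directSum_allOnes_mem_Gam_iff.1 hA, fun B hB => ?_⟩
    have := hmax _ (directSum_allOnes_mem_Gam_iff.2 hB)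
    rw [permanent_directSum, permanent_directSum, permanent_allOnes] at this
    exact Nat.le_of_mul_le_mul_right this (Nat.factorial_pos d)
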